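/- A \emph{matroid} $(E,M)$ is a matroid structure $M$ on a finite set $E$. A \emph{morphism} $(E_1,M_1)\to(E_2,M_2)$ is an injective map $f:E_1\to E_2$ such that a subset of $E_1$ is independent if and only if its image in $E_2$ is independent. A \emph{representation} of $(E,M)$ over a field $K$ is a map $\rho:E\to V$ to a $K$-vector space whose image spans $V$ and such that a subset of $E$ is independent if and only if $\rho$ maps it injectively onto a linearly independent subset of $V$; a matroid is \emph{binary} if it has a representation over $\mathbb{F}_2$. For $r\ge 0$ let $\mathcal{M}(r,\mathbb{F}_2)$ be the category of binary matroids of rank $r$ with all morphisms of matroids, and let $\mathcal{G}\ell(r,\mathbb{F}_2)$ be the category of $r$-dimensional $\mathbb{F}_2$-vector spaces with all linear isomorphisms. Let $H_1(M)$ be the abelian group generated by the elements of $E$ modulo the relations $\sum_{e\in C}e=0$ for all circuits $C$ of $M$, and let $H_1(M;\mathbb{F}_2)=H_1(M)\otimes\mathbb{F}_2$. For a category $\mathcal{C}$ let $B\mathcal{C}$ denote its classifying space, the geometric realization of its nerve, and for a group $G$ let $BG$ be the classifying space of the category with one object and with endomorphism group $G$. **Theorem.** For every integer $r\ge0$, a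 morphism $f$ of binary matroids of rank $r$ induces a linear isomorphism $[e]\mapsto[f(e)]$ of mod-2 homology, and this defines a functor $$F=H_1(-;\mathbb{F}_2):\mathcal{M}(r,\mathbb{F}_2)\to\mathcal{G}\ell(r,\mathbb{F}_2).$$ The induced map of classifying spaces $F_*:B\mathcal{M}(r,\mathbb{F}_2)\to B\mathcal{G}\ell(r,\mathbb{F}_2)$ is a homotopy equivalence, and $B\mathcal{G}\ell(r,\mathbb{F}_2)$ is homotopy equivalent to $BGL(r,\mathbb{F}_2)$. Hence $$B\mathcal{M}(r,\mathbb{F}_2)\simeq B\mathcal{G}\ell(r,\mathbb{F}_2)\simeq BGL(r,\mathbb{F}_2).$$ -/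

import Mathlib

open CategoryTheory TensorProduct

universe u v w

namespace BinaryMatroids

/-! ### Representations and binary matroids -/

/-- A representation of a matroid `M` (on the whole type `E`) over the field `K`: a map `ρ : E → V`
to a `K`-vector space such that a subset of `E` is independent if and only if `ρ` maps it
injectively onto a linearly independent set (this is `LinearIndepOn`), and such that the image
of `ρ` spans `V`. -/
structure IsRepresentation (K : Type v) [Field K] {E : Type u} (M : Matroid E)
    {V : Type w} [AddCommGroup V] [Module K V] (ρ : E → V) : Prop where
  indep_iff : ∀ I : Set E, M.Indep I ↔ LinearIndepOn K ρ I
  span_eq_top : Submodule.span K (Set.range ρ) = ⊤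

/-- A matroid is binary if it is representable over the field with two elements. -/
def IsBinary {E : Type u} (M : Matroid E) : Prop :=
  ∃ (V : Type u) (_ : AddCommGroup V) (_ : Module (ZMod 2) V) (ρ : E → V),
    IsRepresentation (ZMod 2) M ρ

/-! ### The category of matroids and its full subcategory of binary matroids of rank `r` -/

/-- A matroid on a finite set `E`. -/
structure FinMatroid : Type (u + 1) where
  E : Type u
  finite : Finite E
  M : Matroid E
  ground_eq : M.E = Set.univ

/-- A morphism of matroids: an injective map of underlying sets such that a set is independent
if and only if its image is independent. -/
@[ext]
structure FinMatroid.Hom (X Y : FinMatroid.{u}) : Type u where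
  toFun : X.E → Y.E
  injective : Function.Injective toFun
  indep_iff : ∀ I : Set X.E, X.M.Indep I ↔ Y.M.Indep (toFun '' I)

/-- The category of all matroids. -/
instance : Category.{u} FinMatroid.{u} where
  Hom X Y := FinMatroid.Hom X Y
  id X := ⟨id, Function.injective_id, fun I => by simp⟩
  comp f g := ⟨g.toFun ∘ f.toFun, g.injective.comp f.injective, fun I => by
    rw [Set.image_comp, ← g.indep_iff, ← f.indep_iff]⟩

/-- The property of being a binary matroid of rank `r`. -/
def binaryOfRank (r : ℕ) : ObjectProperty FinMatroid.{u} :=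
  fun X => IsBinary X.M ∧ X.M.eRank = (r : ℕ∞)

/-- The category `ℳ(r, 𝔽₂)` of binary matroids of rank `r`. -/
abbrev BinMat (r : ℕ) : Type (u + 1) := (binaryOfRank.{u} r).FullSubcategory

/-! ### The category `𝒢ℓ(r, R)` -/

/-- An `R`-module isomorphic to `R^r`. -/
structure FreeModOfRank (R : Type v) [CommRing R] (r : ℕ) : Type (max v (u + 1)) where
  V : Type u
  [addCommGroup : AddCommGroup V]
  [module : Module R V]
  equiv : Nonempty (V ≃ₗ[R] (Fin r → R))

attribute [instance] FreeModOfRank.addCommGroup FreeModOfRank.module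

/-- The category `𝒢ℓ(r, R)`: modules isomorphic to `R^r`, with all linear isomorphisms
between them as morphisms. -/
instance (R : Type v) [CommRing R] (r : ℕ) : Category.{u} (FreeModOfRank.{u} R r) where
  Hom V W := V.V ≃ₗ[R] W.V
  id V := LinearEquiv.refl R V.V
  comp f g := f.trans g

/-! ### Homology of a matroid -/

section Homology

variable {E : Type u}

/-- The sum of the elements of a finite subset of `E`, in the free abelian group on `E`. -/
noncomputable def chain (C : Finset E) : E →₀ ℤ := ∑ e ∈ C, Finsupp.single e 1

/-- The subgroup of relations: it is generated by the sums `∑ e ∈ C, e`, for all circuits `C`. -/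
noncomputable def circuitRelations (M : Matroid E) : Submodule ℤ (E →₀ ℤ) :=
  Submodule.span ℤ {x | ∃ C : Finset E, M.IsCircuit (C : Set E) ∧ x = chain C}

/-- The first homology group: the free abelian group on `E` modulo `∑ e ∈ C, e = 0` for all
circuits `C`. -/
abbrev H1 (M : Matroid E) : Type u := (E →₀ ℤ) ⧸ circuitRelations M

/-- The first homology group with mod-2 coefficients. -/
abbrev H1Mod2 (M : Matroid E) : Type u := ZMod 2 ⊗[ℤ] H1 M

/-- The class of an element of `E` in the first homology group. -/
noncomputable def cls (M : Matroid E) (e : E) : H1 M :=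
  (circuitRelations M).mkQ (Finsupp.single e 1)

/-- The class of an element of `E` in the mod-2 homology. -/
noncomputable def iota (M : Matroid E) (e : E) : H1Mod2 M := 1 ⊗ₜ[ℤ] cls M e

lemma sum_cls_eq_zero (M : Matroid E) (C : Finset E) (hC : M.IsCircuit (C : Set E)) :
    ∑ e ∈ C, cls M e = 0 := by
  have : ∑ e ∈ C, cls M e = (circuitRelations M).mkQ (chain C) := by
    simp [cls, chain, map_sum]
  rw [this, Submodule.mkQ_apply, Submodule.Quotient.mk_eq_zero]
  exact Submodule.subset_span ⟨C, hC, rfl⟩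

lemma sum_iota_eq_zero (M : Matroid E) (C : Finset E) (hC : M.IsCircuit (C : Set E)) :
    ∑ e ∈ C, iota M e = 0 := by
  simp only [iota, ← TensorProduct.tmul_sum, sum_cls_eq_zero M C hC, TensorProduct.tmul_zero]

/-- A map to an abelian group that kills all circuits induces a homomorphism on `H1`. -/
noncomputable def H1.lift (M : Matroid E) {A : Type w} [AddCommGroup A] (ρ : E → A)
    (h : ∀ C : Finset E, M.IsCircuit (C : Set E) → ∑ e ∈ C, ρ e = 0) : H1 M →ₗ[ℤ] A :=
  (circuitRelations M).liftQ (Finsupp.linearCombination ℤ ρ) (by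
    rw [circuitRelations, Submodule.span_le]
    rintro _ ⟨C, hC, rfl⟩
    simp [chain, map_sum, h C hC])

@[simp]
lemma H1.lift_cls (M : Matroid E) {A : Type w} [AddCommGroup A] (ρ : E → A)
    (h : ∀ C : Finset E, M.IsCircuit (C : Set E) → ∑ e ∈ C, ρ e = 0) (e : E) :
    H1.lift M ρ h (cls M e) = ρ e := by
  simp [H1.lift, cls]

lemma H1.hom_ext {M : Matroid E} {A : Type w} [AddCommGroup A] {f g : H1 M →ₗ[ℤ] A}
    (h : ∀ e, f (cls M e) = g (cls M e)) : f = g := by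
  apply Submodule.linearMap_qext
  apply Finsupp.lhom_ext'
  intro e
  apply LinearMap.ext_ring
  exact h e

lemma H1Mod2.hom_ext {M : Matroid E} {A : Type w} [AddCommGroup A] [Module (ZMod 2) A]
    {f g : H1Mod2 M →ₗ[ZMod 2] A} (h : ∀ e, f (iota M e) = g (iota M e)) : f = g := by
  apply TensorProduct.AlgebraTensorModule.curry_injective
  apply LinearMap.ext_ring
  exact H1.hom_ext h

lemma span_range_iota (M : Matroid E) :
    Submodule.span (ZMod 2) (Set.range (iota M)) = ⊤ := by
  have h : (Submodule.span (ZMod 2) (Set.range (iota M))).mkQ = 0 := by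
    apply H1Mod2.hom_ext
    intro e
    simpa using Submodule.subset_span (Set.mem_range_self e)
  rw [← Submodule.ker_mkQ (Submodule.span (ZMod 2) (Set.range (iota M))), h, LinearMap.ker_zero]

lemma span_iota_base [Finite E] {M : Matroid E} (hM : M.E = Set.univ) {B : Set E}
    (hB : M.IsBase B) : Submodule.span (ZMod 2) (iota M '' B) = ⊤ := by
  classical
  rw [eq_top_iff, ← span_range_iota M, Submodule.span_le]
  rintro _ ⟨e, rfl⟩
  by_cases he : e ∈ B
  · exact Submodule.subset_span ⟨e, he, rfl⟩
  have hC := hB.fundCircuit_isCircuit (x := e) (by simp [hM]) he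
  have hfin : (M.fundCircuit e B).Finite := Set.toFinite _
  have hsum := sum_iota_eq_zero M hfin.toFinset (by simpa using hC)
  have hmem : e ∈ hfin.toFinset := by simpa using M.mem_fundCircuit e B
  rw [← Finset.add_sum_erase _ _ hmem] at hsum
  rw [eq_neg_of_add_eq_zero_left hsum]
  apply Submodule.neg_mem
  apply Submodule.sum_mem
  intro x hx
  rw [Finset.mem_erase, Set.Finite.mem_toFinset] at hx
  have := M.fundCircuit_subset_insert e B hx.2
  exact Submodule.subset_span ⟨x, this.resolve_left hx.1, rfl⟩

/-- An `𝔽₂`-representation kills all circuits. -/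
lemma IsRepresentation.sum_eq_zero {M : Matroid E} {V : Type w} [AddCommGroup V]
    [Module (ZMod 2) V] {ρ : E → V} (hρ : IsRepresentation (ZMod 2) M ρ) (C : Finset E)
    (hC : M.IsCircuit (C : Set E)) : ∑ e ∈ C, ρ e = 0 := by
  classical
  have hdep : ¬ LinearIndepOn (ZMod 2) ρ (C : Set E) := fun h =>
    hC.not_indep ((hρ.indep_iff _).2 h)
  rw [linearIndepOn_finset_iff] at hdep
  push Not at hdep
  obtain ⟨g, hg, i, hi, hgi⟩ := hdep
  have key : ∀ e ∈ C, g e ≠ 0 := by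
    intro e he h0
    have hI := (hρ.indep_iff _).1 (hC.sdiff_singleton_indep (e := e) (by simpa using he))
    have hcoe : ((C : Set E) \ {e}) = ((C.erase e : Finset E) : Set E) := by simp
    rw [hcoe, linearIndepOn_finset_iff] at hI
    have hs : ∑ x ∈ C.erase e, g x • ρ x = 0 := by
      rw [← hg, ← Finset.add_sum_erase _ _ he, h0, zero_smul, zero_add]
    have hie : i ≠ e := fun h => hgi (h ▸ h0)
    exact hgi (hI g hs i (Finset.mem_erase.2 ⟨hie, hi⟩))
  have one : ∀ x : ZMod 2, x ≠ 0 → x = 1 := by decide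
  rw [← hg]
  refine Finset.sum_congr rfl fun e he => ?_
  rw [one _ (key e he), one_smul]

lemma linearIndepOn_iota {M : Matroid E} (hM : IsBinary M) {I : Set E} (hI : M.Indep I) :
    LinearIndepOn (ZMod 2) (iota M) I := by
  obtain ⟨V, _, _, ρ, hρ⟩ := hM
  let φ : H1Mod2 M →ₗ[ZMod 2] V := LinearMap.liftBaseChange (ZMod 2) (H1.lift M ρ hρ.sum_eq_zero)
  have hφ : ∀ e, φ (iota M e) = ρ e := by
    intro e
    simp [φ, iota]
  have h := (hρ.indep_iff I).1 hI
  refine LinearIndependent.of_comp φ ?_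
  have : (φ ∘ fun x : I => iota M x) = fun x : I => ρ x := funext fun x => hφ x
  rw [this]
  exact h

/-- The mod-2 homology of a binary matroid of rank `r` has dimension `r`. -/
lemma nonempty_equiv [Finite E] {M : Matroid E} (hE : M.E = Set.univ) (hM : IsBinary M) {r : ℕ}
    (hr : M.eRank = (r : ℕ∞)) : Nonempty (H1Mod2 M ≃ₗ[ZMod 2] (Fin r → ZMod 2)) := by
  obtain ⟨B, hB⟩ := M.exists_isBase
  have hli : LinearIndependent (ZMod 2) (fun x : B => iota M x) :=
    linearIndepOn_iota hM hB.indep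
  have hsp : ⊤ ≤ Submodule.span (ZMod 2) (Set.range fun x : B => iota M x) := by
    rw [← span_iota_base hE hB, Set.image_eq_range]
  let b := Module.Basis.mk hli hsp
  have hcard : Nat.card B = r := by
    have h := hB.encard_eq_eRank
    rw [hr] at h
    rw [Nat.card_coe_set_eq, Set.ncard, h]
    rfl
  exact ⟨(b.reindex (Finite.equivFinOfCardEq hcard)).equivFun⟩

end Homology

/-! ### The homology functor -/

lemma FinMatroid.Hom.isCircuit_image {X Y : FinMatroid.{u}} (f : FinMatroid.Hom X Y) {C : Set X.E}
    (hC : X.M.IsCircuit C) : Y.M.IsCircuit (f.toFun '' C) := by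
  rw [Matroid.isCircuit_iff_forall_ssubset] at hC ⊢
  refine ⟨?_, ?_⟩
  · rw [← Matroid.not_indep_iff (by simp [Y.ground_eq]), ← f.indep_iff]
    exact hC.1.not_indep
  · intro I hI
    obtain ⟨J, hJ, rfl⟩ := Set.subset_image_iff.1 hI.subset
    rw [← f.indep_iff]
    exact hC.2 (hJ.ssubset_of_ne fun h => hI.ne (by rw [h]))

/-- The homomorphism `H₁(X) → H₁(Y)` with `[e] ↦ [f e]`, for a morphism of matroids `f : X → Y`. -/
noncomputable def H1map {X Y : FinMatroid.{u}} (f : X ⟶ Y) : H1 X.M →ₗ[ℤ] H1 Y.M :=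
  H1.lift X.M (fun e => cls Y.M (f.toFun e)) (by
    classical
    intro C hC
    have h := sum_cls_eq_zero Y.M (C.image f.toFun) (by
      rw [Finset.coe_image]; exact FinMatroid.Hom.isCircuit_image f hC)
    rwa [Finset.sum_image f.injective.injOn] at h)

/-- The map induced by a morphism of matroids on the mod-2 homology. -/
noncomputable def H1Mod2map {X Y : FinMatroid.{u}} (f : X ⟶ Y) :
    H1Mod2 X.M →ₗ[ZMod 2] H1Mod2 Y.M :=
  (H1map f).baseChange (ZMod 2)

lemma H1Mod2map_iota {X Y : FinMatroid.{u}} (f : X ⟶ Y) (e : X.E) :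
    H1Mod2map f (iota X.M e) = iota Y.M (f.toFun e) := by
  simp [H1Mod2map, iota, H1map]

/-- The map induced by a morphism between binary matroids of the same rank is bijective. -/
lemma H1Mod2map_bijective {r : ℕ} {X Y : FinMatroid.{u}} (hX : binaryOfRank r X)
    (hY : binaryOfRank r Y) (f : X ⟶ Y) : Function.Bijective (H1Mod2map f) := by
  have := X.finite
  have := Y.finite
  obtain ⟨eX⟩ := nonempty_equiv X.ground_eq hX.1 hX.2
  obtain ⟨eY⟩ := nonempty_equiv Y.ground_eq hY.1 hY.2
  have : Module.Finite (ZMod 2) (H1Mod2 X.M) := Module.Finite.equiv eX.symm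
  have : Module.Finite (ZMod 2) (H1Mod2 Y.M) := Module.Finite.equiv eY.symm
  obtain ⟨B, hB⟩ := X.M.exists_isBase
  have hind : Y.M.Indep (f.toFun '' B) := (f.indep_iff B).1 hB.indep
  have hbase : Y.M.IsBase (f.toFun '' B) := by
    refine hind.isBase_of_eRk_ge (Set.toFinite _) ?_
    rw [hind.eRk_eq_encard, f.injective.encard_image, hB.encard_eq_eRank, hX.2, hY.2]
  have hsurj : Function.Surjective (H1Mod2map f) := by
    rw [← LinearMap.range_eq_top, eq_top_iff, ← span_iota_base Y.ground_eq hbase,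
      Submodule.span_le]
    rintro _ ⟨_, ⟨e, _, rfl⟩, rfl⟩
    exact ⟨iota X.M e, H1Mod2map_iota f e⟩
  have hfin : Module.finrank (ZMod 2) (H1Mod2 X.M) = Module.finrank (ZMod 2) (H1Mod2 Y.M) :=
    (eX.trans eY.symm).finrank_eq
  exact ⟨(LinearMap.injective_iff_surjective_of_finrank_eq_finrank hfin).2 hsurj, hsurj⟩

/-- The mod-2 homology functor `H₁(-; 𝔽₂) : ℳ(r, 𝔽₂) ⥤ 𝒢ℓ(r, 𝔽₂)`. -/
noncomputable def H1Functor (r : ℕ) : BinMat.{u} r ⥤ FreeModOfRank.{u} (ZMod 2) r where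
  obj X :=
    { V := H1Mod2 X.obj.M
      equiv := by
        have := X.obj.finite
        exact nonempty_equiv X.obj.ground_eq X.property.1 X.property.2 }
  map {X Y} f := LinearEquiv.ofBijective (H1Mod2map f.hom)
    (H1Mod2map_bijective X.property Y.property f.hom)
  map_id X := by
    apply LinearEquiv.toLinearMap_injective
    apply H1Mod2.hom_ext
    intro e
    exact H1Mod2map_iota _ e
  map_comp {X Y Z} f g := by
    apply LinearEquiv.toLinearMap_injective
    apply H1Mod2.hom_ext
    intro e
    refine (H1Mod2map_iota _ e).trans ?_
    refine Eq.symm ((congrArg (H1Mod2map g.hom) (H1Mod2map_iota f.hom e)).trans ?_)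
    exact H1Mod2map_iota g.hom _

/-! ### Classifying spaces -/

/-- The classifying space of a category: the geometric realization of its nerve. -/
noncomputable abbrev B (C : Type u) [Category.{v} C] : TopCat.{max u v} :=
  SSet.toTop.obj (nerve C)

/-- The continuous map of classifying spaces induced by a functor. -/
noncomputable def Bmap {C D : Type u} [Category.{v} C] [Category.{v} D] (F : C ⥤ D) :
    C(B C, B D) :=
  (SSet.toTop.map (nerveMap F)).hom

/-- The classifying space of a discrete group `G`: the classifying space of the category with one
object whose endomorphisms form (a copy in the universe `v` of) the group `G`. -/
noncomputable abbrev BGroup (G : Type u) [Group G] : TopCat.{max u v} :=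
  B (SingleObj (ULift.{v} G))

/-- A continuous map is a homotopy equivalence if it has a homotopy inverse. -/
def IsHomotopyEquiv {X : Type u} {Y : Type v} [TopologicalSpace X] [TopologicalSpace Y]
    (f : C(X, Y)) : Prop :=
  ∃ g : C(Y, X), (g.comp f).Homotopic (ContinuousMap.id X) ∧
    (f.comp g).Homotopic (ContinuousMap.id Y)

end BinaryMatroids

/-! Over `𝔽₂` the only nonzero coefficient is 1, so a minimal linear dependence says exactly that
the vectors of a circuit sum to zero. Hence every representation factors through mod-2 homology, and
`e ↦ [e]` represents a binary matroid in its own homology, functorially (`linearIndepOn_iota_iff`).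

A homotopy inverse of `F` comes from the functor `V` that makes all vectors of a space into a
matroid, which is finite because the field is. Evaluation is a natural isomorphism from `F ∘ V` to
the identity (`vectorMatroidCounit`). For `V ∘ F` the map `e ↦ [e]` is not a morphism when `M` has
loops or parallel elements, since it need not be injective. The disjoint union `E ⊔ H₁(M; 𝔽₂)`, with
the matroid structure pulled back along the obvious map to homology, receives both `M` and `V(F(M))`
naturally, which gives a zigzag `𝟭 ⟶ addVectors ⟵ V ∘ F`. The comparison with `GL(r)` works in the
same way: chosen coordinates give natural transformations between the identities and the composites.

What remains is that a natural transformation induces a homotopy of classifying spaces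
(`homotopic_of_natTrans`). It gives a simplicial homotopy, which is realized one prism at a time:
the prism over an `n`-simplex is glued from `n + 1` simplices along common faces (`exists_prismMap`,
`exists_common_face`). The resulting maps are curried and glued to a map from the realization of `X`
to the paths in the realization of `Y`. -/

namespace BinaryMatroids

/-! ### Points of the standard simplex and the prism decomposition -/

section Prism

/-- The sum of the first coordinates of a point of the standard simplex, up to the index `i`. -/
noncomputable def psum {n : ℕ} (t : stdSimplex ℝ (Fin n)) (i : Fin n) : ℝ :=
  ∑ j with j ≤ i, t j

lemma psum_mono {n : ℕ} (t : stdSimplex ℝ (Fin n)) : Monotone (psum t) := by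
  intro i j hij
  refine Finset.sum_le_sum_of_subset_of_nonneg ?_ fun x _ _ => stdSimplex.zero_le t x
  intro x hx
  simp only [Finset.mem_filter, Finset.mem_univ, true_and] at hx ⊢
  exact hx.trans hij

lemma psum_nonneg {n : ℕ} (t : stdSimplex ℝ (Fin n)) (i : Fin n) : 0 ≤ psum t i :=
  Finset.sum_nonneg fun x _ => stdSimplex.zero_le t x

lemma psum_le_one {n : ℕ} (t : stdSimplex ℝ (Fin n)) (i : Fin n) : psum t i ≤ 1 := by
  rw [← stdSimplex.sum_eq_one t]
  exact Finset.sum_le_sum_of_subset_of_nonneg (Finset.filter_subset _ _)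
    fun x _ _ => stdSimplex.zero_le t x

lemma psum_last {n : ℕ} (t : stdSimplex ℝ (Fin (n + 1))) : psum t (Fin.last n) = 1 := by
  rw [← stdSimplex.sum_eq_one t, psum]
  congr 1
  ext j
  simp [Fin.le_last]

lemma psum_zero {n : ℕ} (t : stdSimplex ℝ (Fin (n + 1))) : psum t 0 = t 0 := by
  rw [psum]
  convert Finset.sum_singleton t 0
  ext j
  simp

lemma psum_succ {n : ℕ} (t : stdSimplex ℝ (Fin (n + 1))) (i : Fin n) :
    psum t i.succ = psum t i.castSucc + t i.succ := by
  have : (Finset.univ.filter fun j : Fin (n + 1) => j ≤ i.succ)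
      = insert i.succ (Finset.univ.filter fun j : Fin (n + 1) => j ≤ i.castSucc) := by
    ext j
    simp only [Finset.mem_filter, Finset.mem_univ, true_and, Finset.mem_insert, Fin.ext_iff,
      Fin.le_def, Fin.val_succ, Fin.val_castSucc]
    lia
  rw [psum, this, Finset.sum_insert (by simp [Fin.le_def]), add_comm, psum]

/-- Together with `exists_psum`, this identifies the simplex with the chains `0 ≤ U 0 ≤ … ≤ U n =
1`. In these coordinates the prism decomposition amounts to inserting one number into a sorted list.
-/
lemma ext_psum {n : ℕ} {t t' : stdSimplex ℝ (Fin (n + 1))} (h : ∀ i, psum t i = psum t' i) :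
    t = t' := by
  ext i
  refine Fin.cases ?_ (fun i => ?_) i
  · rw [← psum_zero, ← psum_zero, h]
  · have h1 := psum_succ t i
    have h2 := psum_succ t' i
    rw [h, h] at h1
    linarith

lemma exists_psum {n : ℕ} (U : Fin (n + 1) → ℝ) (hU : Monotone U) (h0 : 0 ≤ U 0)
    (h1 : U (Fin.last n) = 1) : ∃ t : stdSimplex ℝ (Fin (n + 1)), ∀ i, psum t i = U i := by
  let d : Fin (n + 1) → ℝ := Fin.cons (U 0) fun i => U i.succ - U i.castSucc
  have hsum : ∀ i, ∑ j with j ≤ i, d j = U i := by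
    intro i
    induction i using Fin.induction with
    | zero =>
      have : (Finset.univ.filter fun j : Fin (n + 1) => j ≤ 0) = {0} := by
        ext j
        simp
      rw [this, Finset.sum_singleton]
      rfl
    | succ i ih =>
      have : (Finset.univ.filter fun j : Fin (n + 1) => j ≤ i.succ)
          = insert i.succ (Finset.univ.filter fun j : Fin (n + 1) => j ≤ i.castSucc) := by
        ext j
        simp only [Finset.mem_filter, Finset.mem_univ, true_and, Finset.mem_insert, Fin.ext_iff,
          Fin.le_def, Fin.val_succ, Fin.val_castSucc]
        lia
      rw [this, Finset.sum_insert (by simp [Fin.le_def]), ih]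
      simp [d]
  refine ⟨⟨d, fun i => ?_, ?_⟩, hsum⟩
  · refine Fin.cases h0 (fun i => ?_) i
    simpa [d] using hU i.castSucc_lt_succ.le
  · rw [← h1, ← hsum]
    congr 1
    ext j
    simp [Fin.le_last]

lemma psum_map {m n : ℕ} (f : Fin m → Fin n) (t : stdSimplex ℝ (Fin m)) (i : Fin n) :
    psum (stdSimplex.map f t) i = ∑ j with f j ≤ i, t j := by
  rw [psum]
  simp only [stdSimplex.map_coe, FunOnFinite.linearMap_apply_apply]
  rw [← Finset.sum_fiberwise_of_maps_to (s := Finset.univ.filter fun j => f j ≤ i)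
    (t := Finset.univ.filter fun j => j ≤ i) (g := f) (by simp)]
  refine Finset.sum_congr rfl fun j hj => Finset.sum_congr ?_ fun _ _ => rfl
  ext x
  simp only [Finset.mem_filter, Finset.mem_univ, true_and] at hj ⊢
  constructor
  · rintro rfl
    exact ⟨hj, rfl⟩
  · exact fun h => h.2

/-- When the preimage of an initial segment is an initial segment, pushing forward only reindexes
partial sums. -/
lemma psum_map_eq {m n : ℕ} {f : Fin m → Fin n} {t : stdSimplex ℝ (Fin m)} {i : Fin n}
    {i' : Fin m} (h : ∀ j, f j ≤ i ↔ j ≤ i') : psum (stdSimplex.map f t) i = psum t i' := by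
  rw [psum_map, psum]
  simp only [h]

/-- The degeneracy of the prism decomposition that repeats the vertex `k`. -/
def prismFst (n : SimplexCategory) (k : Fin (n.len + 1)) :
    SimplexCategory.mk (n.len + 1) ⟶ n :=
  SimplexCategory.Hom.mk ⟨k.predAbove, Fin.predAbove_right_monotone k⟩

/-- The map to `[1]` in the prism decomposition that jumps after the vertex `k`. -/
def prismSnd (n : SimplexCategory) (k : Fin (n.len + 1)) :
    SimplexCategory.mk (n.len + 1) ⟶ SimplexCategory.mk 1 :=
  SimplexCategory.Hom.mk ⟨fun j => if j ≤ k.castSucc then 0 else 1, fun i j h => by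
    by_cases hj : j ≤ k.castSucc
    · simp [hj, h.trans hj]
    · simp only [hj, if_false]
      exact Fin.le_last _⟩

lemma prismFst_apply (n : SimplexCategory) (k : Fin (n.len + 1)) (j : Fin (n.len + 2)) :
    (prismFst n k : Fin (n.len + 2) → Fin (n.len + 1)) j = k.predAbove j := rfl

lemma prismSnd_apply (n : SimplexCategory) (k : Fin (n.len + 1)) (j : Fin (n.len + 2)) :
    (prismSnd n k : Fin (n.len + 2) → Fin 2) j = if j ≤ k.castSucc then 0 else 1 := rfl

/-- On partial sums, `prismFst` deletes the entry at `k`, and `prismSnd` keeps that entry alone. -/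
lemma psum_prismFst {n : SimplexCategory} (k i : Fin (n.len + 1))
    (w : stdSimplex ℝ (Fin (n.len + 2))) :
    psum (stdSimplex.map (prismFst n k) w) i = psum w (k.castSucc.succAbove i) := by
  refine psum_map_eq fun j => ?_
  rw [prismFst_apply, Fin.predAbove, Fin.succAbove]
  simp only [Fin.lt_def, Fin.le_def, Fin.val_castSucc]
  split_ifs <;> simp <;> lia

lemma psum_prismSnd {n : SimplexCategory} (k : Fin (n.len + 1))
    (w : stdSimplex ℝ (Fin (n.len + 2))) :
    psum (stdSimplex.map (prismSnd n k) w) (0 : Fin 2) = psum w k.castSucc := by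
  refine psum_map_eq fun j => ?_
  rw [prismSnd_apply]
  split_ifs with h <;> simp [h]

lemma ext_psum_two {s s' : stdSimplex ℝ (Fin 2)} (h : psum s 0 = psum s' 0) : s = s' := by
  refine ext_psum fun i => ?_
  fin_cases i
  · exact h
  · exact (psum_last s).trans (psum_last s').symm

/-- The embeddings of the top-dimensional simplices of the prism. -/
noncomputable def prismMap (n : SimplexCategory) (k : Fin (n.len + 1))
    (w : stdSimplex ℝ (Fin (n.len + 2))) :
    stdSimplex ℝ (Fin (n.len + 1)) × stdSimplex ℝ (Fin 2) :=
  (stdSimplex.map (prismFst n k) w, stdSimplex.map (prismSnd n k) w)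

/-- The two components jointly retain all partial sums of `w`. -/
lemma prismMap_injective (n : SimplexCategory) (k : Fin (n.len + 1)) :
    Function.Injective (prismMap n k) := by
  intro w w' h
  refine ext_psum fun j => ?_
  obtain rfl | ⟨i, rfl⟩ := Fin.eq_self_or_eq_succAbove k.castSucc j
  · rw [← psum_prismSnd, ← psum_prismSnd]
    exact congrArg (fun p => psum p.2 0) h
  · rw [← psum_prismFst, ← psum_prismFst]
    exact congrArg (fun p => psum p.1 i) h

lemma exists_prismMap {n : SimplexCategory}
    (p : stdSimplex ℝ (Fin (n.len + 1)) × stdSimplex ℝ (Fin 2)) :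
    ∃ k w, prismMap n k w = p := by
  obtain ⟨t, s⟩ := p
  have hex : ∃ i : Fin (n.len + 1), psum s 0 ≤ psum t i :=
    ⟨Fin.last _, (psum_le_one s 0).trans (psum_last t).ge⟩
  -- The number `psum s 0` is to be inserted just before the first partial sum of `t` that is not
  -- smaller. One exists because the last partial sum is 1.
  obtain ⟨k, hk, hmin⟩ := WellFounded.has_min (r := (· < ·)) wellFounded_lt
    {i : Fin (n.len + 1) | psum s 0 ≤ psum t i} hex
  have hlt : ∀ i < k, psum t i ≤ psum s 0 := fun i hi => by
    by_contra! h
    exact hmin i h.le hi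
  have hle : ∀ i, k ≤ i → psum s 0 ≤ psum t i := fun i hi =>
    le_trans hk (psum_mono t hi)
  let U : Fin (n.len + 2) → ℝ := k.castSucc.insertNth (psum s 0) (psum t)
  have hU1 : U k.castSucc = psum s 0 := by simp [U]
  have hU2 : ∀ i, U (k.castSucc.succAbove i) = psum t i := by simp [U]
  have hUc : ∀ i < k, U i.castSucc = psum t i := fun i hi => by
    rw [← hU2, Fin.succAbove_of_castSucc_lt _ _ (by simpa using hi)]
  have hUs : ∀ i, k ≤ i → U i.succ = psum t i := fun i hi => by
    rw [← hU2, Fin.succAbove_of_le_castSucc _ _ (by simpa using hi)]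
  have hmono : Monotone U := by
    refine Fin.monotone_iff_le_succ.2 fun i => ?_
    rcases lt_trichotomy i k with h | rfl | h
    · rw [hUc i h]
      by_cases h' : i.succ = k.castSucc
      · rw [h', hU1]
        exact hlt i h
      · have hl : (i : ℕ) + 1 < k := by
          have := Fin.lt_def.1 h
          have : (i : ℕ) + 1 ≠ k := fun e => h' (Fin.ext (by simpa using e))
          lia
        have e : i.succ = (⟨i + 1, by lia⟩ : Fin (n.len + 1)).castSucc := rfl
        rw [e, hUc _ (Fin.lt_def.2 hl)]
        exact psum_mono t (Fin.le_def.2 (by simp))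
    · rw [hU1, hUs i le_rfl]
      exact hle i le_rfl
    · rw [hUs i h.le]
      have hi : 0 < (i : ℕ) := lt_of_le_of_lt (Nat.zero_le _) (Fin.lt_def.1 h)
      have e : i.castSucc = (⟨i - 1, by lia⟩ : Fin (n.len + 1)).succ :=
        Fin.ext (by simp; lia)
      rw [e, hUs _ (Fin.le_def.2 (by have := Fin.lt_def.1 h; simp; lia))]
      exact psum_mono t (Fin.le_def.2 (by simp))
  have h0 : 0 ≤ U 0 := by
    obtain h | ⟨i, h⟩ := Fin.eq_self_or_eq_succAbove k.castSucc 0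
    · rw [h, hU1]
      exact psum_nonneg _ _
    · rw [h, hU2]
      exact psum_nonneg _ _
  have h1 : U (Fin.last _) = 1 := by
    rw [← Fin.succ_last, hUs _ (Fin.le_last _), psum_last]
  obtain ⟨w, hw⟩ := exists_psum U hmono h0 h1
  refine ⟨k, w, Prod.ext (ext_psum fun i => ?_) (ext_psum_two ?_)⟩
  · exact (psum_prismFst k i w).trans (by rw [hw, hU2])
  · exact (psum_prismSnd k w).trans (by rw [hw, hU1])

/-- Every simplex of `Δ[n] × Δ[1]` lies in one of the top-dimensional simplices of the prism. -/
lemma exists_factor {m n : SimplexCategory} (φ : m ⟶ n) (χ : m ⟶ SimplexCategory.mk 1) :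
    ∃ (k : Fin (n.len + 1)) (θ : m ⟶ SimplexCategory.mk (n.len + 1)),
      θ ≫ prismFst n k = φ ∧ θ ≫ prismSnd n k = χ := by
  -- `k` is the `φ`-image of the last vertex where `χ` is 0, or 0 if there is none. The jump of `χ`
  -- then happens at `k`.
  have hk : ∃ k : Fin (n.len + 1), ∀ j : Fin (m.len + 1),
      ((χ : Fin (m.len + 1) → Fin 2) j = 0 → (φ : Fin (m.len + 1) → Fin (n.len + 1)) j ≤ k) ∧
      ((χ : Fin (m.len + 1) → Fin 2) j = 1 →
        k ≤ (φ : Fin (m.len + 1) → Fin (n.len + 1)) j) := by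
    by_cases h : ∃ j : Fin (m.len + 1), (χ : Fin (m.len + 1) → Fin 2) j = 0
    · obtain ⟨j, hj, hmax⟩ := WellFounded.has_min (r := (· > ·)) wellFounded_gt
        {j : Fin (m.len + 1) | (χ : Fin (m.len + 1) → Fin 2) j = 0} h
      refine ⟨(φ : Fin (m.len + 1) → Fin (n.len + 1)) j, fun i => ⟨fun hi => ?_, fun hi => ?_⟩⟩
      · exact φ.toOrderHom.monotone (not_lt.1 (hmax i hi))
      · refine φ.toOrderHom.monotone (le_of_not_ge fun hij => ?_)
        have h2 : (χ : Fin (m.len + 1) → Fin 2) i ≤ (χ : Fin (m.len + 1) → Fin 2) j :=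
          χ.toOrderHom.monotone hij
        rw [hi, hj] at h2
        exact absurd h2 (by decide)
    · exact ⟨0, fun j => ⟨fun hj => (h ⟨j, hj⟩).elim, fun _ => Fin.zero_le _⟩⟩
  obtain ⟨k, hk⟩ := hk
  have h01 : ∀ a : Fin 2, a = 0 ∨ a = 1 := by decide
  -- `castSucc` and `succ` are right inverse to `k.predAbove` on indices `≤ k` and `≥ k`
  -- respectively.
  let θ : m ⟶ SimplexCategory.mk (n.len + 1) := SimplexCategory.Hom.mk
    ⟨fun j => if (χ : Fin (m.len + 1) → Fin 2) j = 0
      then ((φ : Fin (m.len + 1) → Fin (n.len + 1)) j).castSucc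
      else ((φ : Fin (m.len + 1) → Fin (n.len + 1)) j).succ, fun i j hij => by
        have h1 : (φ : Fin (m.len + 1) → Fin (n.len + 1)) i ≤
          (φ : Fin (m.len + 1) → Fin (n.len + 1)) j := φ.toOrderHom.monotone hij
        have h2 : (χ : Fin (m.len + 1) → Fin 2) i ≤ (χ : Fin (m.len + 1) → Fin 2) j :=
          χ.toOrderHom.monotone hij
        dsimp only
        split_ifs with hi hj hj
        · simpa using h1
        · exact (Fin.castSucc_le_castSucc_iff.2 h1).trans Fin.castSucc_lt_succ.le
        · rw [hj] at h2
          exact absurd (le_antisymm h2 (Fin.zero_le _)) hi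
        · simpa using h1⟩
  have hθ : ∀ j : Fin (m.len + 1), (θ : Fin (m.len + 1) → Fin (n.len + 2)) j =
      if (χ : Fin (m.len + 1) → Fin 2) j = 0
      then ((φ : Fin (m.len + 1) → Fin (n.len + 1)) j).castSucc
      else ((φ : Fin (m.len + 1) → Fin (n.len + 1)) j).succ := fun j => rfl
  refine ⟨k, θ, ?_, ?_⟩
  · refine SimplexCategory.Hom.ext _ _ (OrderHom.ext _ _ (funext fun j => ?_))
    change (prismFst n k : Fin (n.len + 2) → Fin (n.len + 1))
      ((θ : Fin (m.len + 1) → Fin (n.len + 2)) j) = (φ : Fin (m.len + 1) → Fin (n.len + 1)) j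
    rw [prismFst_apply, hθ]
    rcases h01 ((χ : Fin (m.len + 1) → Fin 2) j) with h | h
    · rw [if_pos h, Fin.predAbove_castSucc_of_le _ _ ((hk j).1 h)]
    · rw [if_neg (by rw [h]; decide), Fin.predAbove_succ_of_le _ _ ((hk j).2 h)]
  · refine SimplexCategory.Hom.ext _ _ (OrderHom.ext _ _ (funext fun j => ?_))
    change (prismSnd n k : Fin (n.len + 2) → Fin 2)
      ((θ : Fin (m.len + 1) → Fin (n.len + 2)) j) = (χ : Fin (m.len + 1) → Fin 2) j
    rw [prismSnd_apply, hθ]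
    rcases h01 ((χ : Fin (m.len + 1) → Fin 2) j) with h | h
    · rw [if_pos h, h, if_pos (by simpa using (hk j).1 h)]
    · have h0 : (χ : Fin (m.len + 1) → Fin 2) j ≠ 0 := by rw [h]; decide
      rw [if_neg h0, h]
      refine if_neg ?_
      rw [not_le, Fin.castSucc_lt_succ_iff]
      exact (hk j).2 h

lemma stdSimplex_map_comp {a b c : SimplexCategory} (f : a ⟶ b) (g : b ⟶ c)
    (w : stdSimplex ℝ (Fin (a.len + 1))) :
    stdSimplex.map g (stdSimplex.map f w) = stdSimplex.map (f ≫ g) w :=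
  stdSimplex.map_comp_apply _ _ _

lemma stdSimplex_map_id (n : SimplexCategory) (w : stdSimplex ℝ (Fin (n.len + 1))) :
    stdSimplex.map (ConcreteCategory.hom (𝟙 n)) w = w :=
  stdSimplex.map_id_apply w

/-- A point that lies in two of the top-dimensional simplices of the prism lies in a
common face. -/
lemma exists_common_face {n : SimplexCategory} {k k' : Fin (n.len + 1)} (hk : k < k')
    {w w' : stdSimplex ℝ (Fin (n.len + 2))} (h : prismMap n k w = prismMap n k' w') :
    ∃ (t : stdSimplex ℝ (Fin (n.len + 1))) (θ : n ⟶ SimplexCategory.mk (n.len + 1)),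
      w = stdSimplex.map θ t ∧ w' = stdSimplex.map θ t ∧
      θ ≫ prismFst n k = θ ≫ prismFst n k' ∧ θ ≫ prismSnd n k = θ ≫ prismSnd n k' := by
  have hkn : (k : ℕ) < k' := hk
  obtain ⟨q, hq⟩ : ∃ q : Fin (n.len + 1), (q : ℕ) + 1 = k' := ⟨⟨k' - 1, by lia⟩, by simp; lia⟩
  -- The coordinates of the common point `t` strictly between `k` and `k'` will turn out to vanish.
  -- The values of `θf` there are chosen only to keep it monotone and to make the two composites
  -- agree, with first component `ψ`.
  let θf : Fin (n.len + 1) → Fin (n.len + 2) := fun i =>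
    if i ≤ k then i.castSucc else if i < k' then k.castSucc else i.succ
  have hθm : Monotone θf := by
    intro i j hij
    simp only [θf, Fin.le_def, Fin.lt_def] at hij ⊢
    split_ifs <;> simp <;> lia
  let θ : n ⟶ SimplexCategory.mk (n.len + 1) := SimplexCategory.Hom.mk ⟨θf, hθm⟩
  have hval : ∀ i, (θf i : ℕ) = if (i : ℕ) ≤ k then (i : ℕ) else if (i : ℕ) < k' then (k : ℕ)
      else i + 1 := by
    intro i
    simp only [θf, Fin.le_def, Fin.lt_def]
    split_ifs <;> simp
  let ψ : Fin (n.len + 1) → Fin (n.len + 1) := fun i => if k < i ∧ i < k' then k else i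
  have hψ : ∀ i, k.predAbove (θf i) = ψ i := by
    intro i
    ext
    have := hval i
    simp only [ψ, Fin.predAbove, Fin.lt_def, Fin.val_castSucc]
    split_ifs at this ⊢ <;> simp <;> lia
  have hψ' : ∀ i, k'.predAbove (θf i) = ψ i := by
    intro i
    ext
    have := hval i
    simp only [ψ, Fin.predAbove, Fin.lt_def, Fin.val_castSucc]
    split_ifs at this ⊢ <;> simp <;> lia
  have hχ : ∀ i, θf i ≤ k.castSucc ↔ i ≤ q := by
    intro i
    have := hval i
    simp only [Fin.le_def, Fin.val_castSucc]
    split_ifs at this <;> lia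
  have hχ' : ∀ i, θf i ≤ k'.castSucc ↔ i ≤ q := by
    intro i
    have := hval i
    simp only [Fin.le_def, Fin.val_castSucc]
    split_ifs at this <;> lia
  have hfst : θ ≫ prismFst n k = θ ≫ prismFst n k' :=
    SimplexCategory.Hom.ext _ _ (OrderHom.ext _ _ (funext fun i =>
      (hψ i).trans (hψ' i).symm))
  have hsnd : θ ≫ prismSnd n k = θ ≫ prismSnd n k' :=
    SimplexCategory.Hom.ext _ _ (OrderHom.ext _ _ (funext fun i => by
      change (if θf i ≤ k.castSucc then (0 : Fin 2) else 1) =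
        if θf i ≤ k'.castSucc then (0 : Fin 2) else 1
      simp only [hχ, hχ']))
  let t := (prismMap n k w).1
  have ht : t = stdSimplex.map (prismFst n k) w := rfl
  have ht' : t = stdSimplex.map (prismFst n k') w' := congrArg Prod.fst h
  let s := (prismMap n k w).2
  have hs : psum s 0 = psum w k.castSucc := psum_prismSnd k w
  have hs' : psum s 0 = psum w' k'.castSucc := by
    rw [← psum_prismSnd]
    exact congrArg (fun p => psum p.2 0) h
  -- The inserted number lies at or below the `k`-th partial sum of `t` by the first simplex, and at
  -- or above the `(k' - 1)`-th by the second. Monotonicity makes all partial sums from `k` to `q =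
  -- k' - 1` equal to it.
  have h1 : psum s 0 ≤ psum t k := by
    rw [hs, ht, psum_prismFst, Fin.succAbove_castSucc_self]
    exact psum_mono w k.castSucc_lt_succ.le
  have h2 : psum t q ≤ psum s 0 := by
    rw [hs', ht', psum_prismFst, Fin.succAbove_of_castSucc_lt _ _
      (Fin.castSucc_lt_castSucc_iff.2 (Fin.lt_def.2 (by lia)))]
    exact psum_mono w' (Fin.castSucc_le_castSucc_iff.2 (Fin.le_def.2 (by lia)))
  have hmid : ∀ i, k ≤ i → i ≤ q → psum t i = psum s 0 := fun i hi hi' =>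
    le_antisymm ((psum_mono t hi').trans h2) (h1.trans (psum_mono t hi))
  have hkq : k ≤ q := Fin.le_def.2 (by lia)
  -- `ψ` moves only indices at which `t` has coordinate zero.
  have hψt : stdSimplex.map ψ t = t := by
    refine ext_psum fun i => ?_
    by_cases hi : k ≤ i ∧ i ≤ q
    · rw [hmid i hi.1 hi.2, ← hmid q hkq le_rfl]
      refine psum_map_eq fun j => ?_
      simp only [ψ, Fin.le_def, Fin.lt_def] at hi ⊢
      split_ifs <;> lia
    · refine psum_map_eq fun j => ?_
      simp only [ψ, Fin.le_def, Fin.lt_def] at hi ⊢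
      split_ifs <;> lia
  -- Since `prismMap` is injective on each simplex, the points may be compared inside the prism.
  have key : prismMap n k (stdSimplex.map θ t) = prismMap n k w := by
    refine Prod.ext ?_ (ext_psum_two ?_)
    · change stdSimplex.map (prismFst n k) (stdSimplex.map θ t) = t
      rw [stdSimplex_map_comp]
      conv_rhs => rw [← hψt]
      exact congrArg (fun f => stdSimplex.map f t) (funext hψ)
    · change psum (stdSimplex.map (prismSnd n k) (stdSimplex.map θ t)) 0 = psum s 0
      rw [psum_prismSnd, ← hmid q hkq le_rfl]
      exact psum_map_eq hχ
  have key' : prismMap n k' (stdSimplex.map θ t) = prismMap n k' w' := by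
    rw [← h, ← key]
    refine Prod.ext ?_ ?_
    · change stdSimplex.map (prismFst n k') (stdSimplex.map θ t) =
        stdSimplex.map (prismFst n k) (stdSimplex.map θ t)
      rw [stdSimplex_map_comp, stdSimplex_map_comp, hfst]
    · change stdSimplex.map (prismSnd n k') (stdSimplex.map θ t) =
        stdSimplex.map (prismSnd n k) (stdSimplex.map θ t)
      rw [stdSimplex_map_comp, stdSimplex_map_comp, hsnd]
  exact ⟨t, θ, (prismMap_injective n k key).symm, (prismMap_injective n k' key').symm,
    hfst, hsnd⟩

lemma continuous_prismMap (n : SimplexCategory) (k : Fin (n.len + 1)) :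
    Continuous (prismMap n k) :=
  (stdSimplex.continuous_map _).prodMk (stdSimplex.continuous_map _)

/-- The prism is a quotient of the disjoint union of its top-dimensional simplices. -/
lemma isQuotientMap_prism (n : SimplexCategory) :
    Topology.IsQuotientMap fun p : (_ : Fin (n.len + 1)) × stdSimplex ℝ (Fin (n.len + 2)) =>
      prismMap n p.1 p.2 := by
  have hc : Continuous fun p : (_ : Fin (n.len + 1)) × stdSimplex ℝ (Fin (n.len + 2)) =>
      prismMap n p.1 p.2 := continuous_sigma fun k => continuous_prismMap n k
  refine hc.isClosedMap.isQuotientMap hc fun p => ?_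
  obtain ⟨k, w, h⟩ := exists_prismMap p
  exact ⟨⟨k, w⟩, h⟩

/-- A map out of the prism is given by a compatible family of maps on its top-dimensional
simplices. -/
lemma exists_prism_desc {Z : Type u} [TopologicalSpace Z] (n : SimplexCategory)
    (f : Fin (n.len + 1) → stdSimplex ℝ (Fin (n.len + 2)) → Z) (hc : ∀ k, Continuous (f k))
    (hf : ∀ k k' w w', prismMap n k w = prismMap n k' w' → f k w = f k' w') :
    ∃ g : C(stdSimplex ℝ (Fin (n.len + 1)) × stdSimplex ℝ (Fin 2), Z),
      ∀ k w, g (prismMap n k w) = f k w := by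
  choose k w hkw using exists_prismMap (n := n)
  have hg : ∀ k' w', f (k (prismMap n k' w')) (w (prismMap n k' w')) = f k' w' :=
    fun k' w' => hf _ _ _ _ (hkw _)
  refine ⟨⟨fun p => f (k p) (w p), ?_⟩, hg⟩
  rw [(isQuotientMap_prism n).continuous_iff]
  exact continuous_sigma fun k' => (hc k').congr fun w' => (hg k' w').symm

end Prism

end BinaryMatroids

namespace BinaryMatroids

/-! ### Maps out of a geometric realization -/

section Realization

variable {X Y : SSet.{u}}

/-- The point of the geometric realization of `X` given by a simplex of `X` and a point of the
standard topological simplex. -/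
noncomputable def realPt {n : SimplexCategory} (x : X.obj (Opposite.op n))
    (t : stdSimplex ℝ (Fin (n.len + 1))) : SSet.toTop.obj X :=
  SSet.toTop.map (SSet.yonedaEquiv.symm x) (n.toTopHomeo.symm t)

lemma continuous_realPt {n : SimplexCategory} (x : X.obj (Opposite.op n)) :
    Continuous (realPt x) :=
  (SSet.toTop.map (SSet.yonedaEquiv.symm x)).hom.continuous.comp n.toTopHomeo.symm.continuous

lemma yonedaEquiv_symm_map {m n : SimplexCategory} (f : m ⟶ n) (x : X.obj (Opposite.op n)) :
    SSet.yonedaEquiv.symm (X.map f.op x) =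
      SSet.stdSimplex.map f ≫ SSet.yonedaEquiv.symm x := by
  apply SSet.yonedaEquiv.injective
  rw [Equiv.apply_symm_apply, SSet.yonedaEquiv_comp, SSet.yonedaEquiv_map]
  exact (SSet.yonedaEquiv_symm_app_objEquiv_symm x f).symm

/-- This is the gluing relation of the realization. -/
lemma realPt_map {m n : SimplexCategory} (f : m ⟶ n) (x : X.obj (Opposite.op n))
    (t : stdSimplex ℝ (Fin (m.len + 1))) :
    realPt (X.map f.op x) t = realPt x (stdSimplex.map f t) := by
  rw [realPt, realPt, yonedaEquiv_symm_map, SimplexCategory.toTopHomeo_symm_naturality_apply,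
    Functor.map_comp]
  rfl

lemma map_realPt (g : X ⟶ Y) {n : SimplexCategory} (x : X.obj (Opposite.op n))
    (t : stdSimplex ℝ (Fin (n.len + 1))) :
    SSet.toTop.map g (realPt x t) = realPt (g.app _ x) t := by
  rw [realPt, realPt, ← SSet.yonedaEquiv_symm_comp, Functor.map_comp]
  rfl

lemma toSSetObjEquiv_homEquiv {Z : TopCat.{u}} (f : SSet.toTop.obj X ⟶ Z) {n : SimplexCategory}
    (x : X.obj (Opposite.op n)) (t : stdSimplex ℝ (Fin (n.len + 1))) :
    Z.toSSetObjEquiv _ ((sSetTopAdj.homEquiv X Z f).app _ x) t = f (realPt x t) := by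
  rw [Adjunction.homEquiv_unit]
  change ((((sSetTopAdj.unit.app X).app (Opposite.op n)) x).down ≫ f) (ULift.up t) = _
  rw [sSetTopAdj_unit_app_app_down]
  rfl

/-- By adjunction such a map is a simplicial map from `X` to the singular set of `Z`, whose value on
`x` is the singular simplex `t ↦ f (realPt x t)`. -/
lemma realization_hom_ext {Z : TopCat.{u}} {f g : SSet.toTop.obj X ⟶ Z}
    (h : ∀ (n : SimplexCategory) (x : X.obj (Opposite.op n))
      (t : stdSimplex ℝ (Fin (n.len + 1))), f (realPt x t) = g (realPt x t)) : f = g := by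
  apply (sSetTopAdj.homEquiv X Z).injective
  ext n x
  apply (Z.toSSetObjEquiv _).injective
  ext t
  induction n with | op n => ?_
  exact Eq.trans (toSSetObjEquiv_homEquiv f x t)
    ((h n x t).trans (toSSetObjEquiv_homEquiv g x t).symm)

/-- A compatible family of maps from simplices defines a map from the geometric realization. -/
lemma exists_realization_lift {Z : TopCat.{u}}
    (F : ∀ (n : SimplexCategory), X.obj (Opposite.op n) → C(stdSimplex ℝ (Fin (n.len + 1)), Z))
    (hF : ∀ (m n : SimplexCategory) (f : m ⟶ n) (x : X.obj (Opposite.op n))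
      (t : stdSimplex ℝ (Fin (m.len + 1))), F m (X.map f.op x) t = F n x (stdSimplex.map f t)) :
    ∃ f : SSet.toTop.obj X ⟶ Z, ∀ (n : SimplexCategory) (x : X.obj (Opposite.op n))
      (t : stdSimplex ℝ (Fin (n.len + 1))), f (realPt x t) = F n x t := by
  let φ : X ⟶ TopCat.toSSet.obj Z :=
    { app := fun n => ↾fun x => (Z.toSSetObjEquiv n).symm (F n.unop x)
      naturality := by
        intro m n f
        ext x
        apply (Z.toSSetObjEquiv _).injective
        ext t
        exact hF _ _ f.unop x t }
  refine ⟨(sSetTopAdj.homEquiv X Z).symm φ, fun n x t => ?_⟩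
  rw [← toSSetObjEquiv_homEquiv, Equiv.apply_symm_apply]
  rfl

end Realization

/-! ### Simplicial homotopies induce homotopies -/

section Homotopy

variable {X Y : SSet.{u}}

/-- A simplicial homotopy, written in terms of maps to `[1]`: a simplicial map
`X × Δ[1] → Y`. -/
structure PrismHomotopy (X Y : SSet.{u}) where
  app : ∀ n : SimplexCategory, X.obj (Opposite.op n) → (n ⟶ SimplexCategory.mk 1) →
    Y.obj (Opposite.op n)
  app_map : ∀ {m n : SimplexCategory} (f : m ⟶ n) (x : X.obj (Opposite.op n))
    (χ : n ⟶ SimplexCategory.mk 1), app m (X.map f.op x) (f ≫ χ) = Y.map f.op (app n x χ)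

namespace PrismHomotopy

variable (H : PrismHomotopy X Y)

/-- The point of the realization of `Y` given by a simplex of `Δ[n] × Δ[1]`. -/
noncomputable def pt {m n : SimplexCategory} (x : X.obj (Opposite.op n)) (φ : m ⟶ n)
    (χ : m ⟶ SimplexCategory.mk 1) (t : stdSimplex ℝ (Fin (m.len + 1))) : SSet.toTop.obj Y :=
  realPt (H.app m (X.map φ.op x) χ) t

lemma continuous_pt {m n : SimplexCategory} (x : X.obj (Opposite.op n)) (φ : m ⟶ n)
    (χ : m ⟶ SimplexCategory.mk 1) : Continuous (H.pt x φ χ) :=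
  continuous_realPt _

lemma pt_map {l m n : SimplexCategory} (x : X.obj (Opposite.op n)) (θ : l ⟶ m) (φ : m ⟶ n)
    (χ : m ⟶ SimplexCategory.mk 1) (t : stdSimplex ℝ (Fin (l.len + 1))) :
    H.pt x φ χ (stdSimplex.map θ t) = H.pt x (θ ≫ φ) (θ ≫ χ) t := by
  rw [pt, pt, ← realPt_map, ← H.app_map, op_comp, Functor.map_comp]
  rfl

/-- Two different top-dimensional simplices meet in common faces, and on such a face both values are
given by the same simplex of `Δ[n] × Δ[1]`. -/
lemma pt_eq_of_prismMap_eq {n : SimplexCategory} (x : X.obj (Opposite.op n))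
    {k k' : Fin (n.len + 1)} {w w' : stdSimplex ℝ (Fin (n.len + 2))}
    (h : prismMap n k w = prismMap n k' w') :
    H.pt x (prismFst n k) (prismSnd n k) w = H.pt x (prismFst n k') (prismSnd n k') w' := by
  have key : ∀ {k k' : Fin (n.len + 1)} {w w' : stdSimplex ℝ (Fin (n.len + 2))}, k < k' →
      prismMap n k w = prismMap n k' w' →
      H.pt x (prismFst n k) (prismSnd n k) w = H.pt x (prismFst n k') (prismSnd n k') w' := by
    intro k k' w w' hk h
    obtain ⟨t, θ, rfl, rfl, h1, h2⟩ := exists_common_face hk h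
    exact (H.pt_map x θ _ _ t).trans ((by rw [h1, h2] : _ = _).trans (H.pt_map x θ _ _ t).symm)
  rcases lt_trichotomy k k' with hk | rfl | hk
  · exact key hk h
  · rw [prismMap_injective n k h]
  · exact (key hk h.symm).symm

/-- The map from the prism to the realization of `Y` defined by a simplex of `X`. -/
lemma exists_prism_lift {n : SimplexCategory} (x : X.obj (Opposite.op n)) :
    ∃ g : C(stdSimplex ℝ (Fin (n.len + 1)) × stdSimplex ℝ (Fin 2), SSet.toTop.obj Y),
      ∀ (m : SimplexCategory) (φ : m ⟶ n) (χ : m ⟶ SimplexCategory.mk 1)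
        (t : stdSimplex ℝ (Fin (m.len + 1))),
        g (stdSimplex.map φ t, stdSimplex.map χ t) = H.pt x φ χ t := by
  obtain ⟨g, hg⟩ := exists_prism_desc n
    (fun k w => H.pt x (prismFst n k) (prismSnd n k) w) (fun k => H.continuous_pt x _ _)
    (fun k k' w w' h => H.pt_eq_of_prismMap_eq x h)
  refine ⟨g, fun m φ χ t => ?_⟩
  obtain ⟨k, θ, rfl, rfl⟩ := exists_factor φ χ
  rw [← H.pt_map, ← stdSimplex_map_comp, ← stdSimplex_map_comp]
  exact hg k (stdSimplex.map θ t)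

/-- The map from the prism to the realization of `Y` defined by a simplex of `X`. -/
noncomputable def prismLift {n : SimplexCategory} (x : X.obj (Opposite.op n)) :
    C(stdSimplex ℝ (Fin (n.len + 1)) × stdSimplex ℝ (Fin 2), SSet.toTop.obj Y) :=
  (H.exists_prism_lift x).choose

lemma prismLift_apply {m n : SimplexCategory} (x : X.obj (Opposite.op n)) (φ : m ⟶ n)
    (χ : m ⟶ SimplexCategory.mk 1) (t : stdSimplex ℝ (Fin (m.len + 1))) :
    H.prismLift x (stdSimplex.map φ t, stdSimplex.map χ t) = H.pt x φ χ t :=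
  (H.exists_prism_lift x).choose_spec m φ χ t

/-- This compatibility lets the prisms over all simplices of `X` be glued. It suffices to check it
on the top-dimensional simplices of the prism over `m`. -/
lemma prismLift_map {m n : SimplexCategory} (f : m ⟶ n) (x : X.obj (Opposite.op n))
    (t : stdSimplex ℝ (Fin (m.len + 1))) (s : stdSimplex ℝ (Fin 2)) :
    H.prismLift (X.map f.op x) (t, s) = H.prismLift x (stdSimplex.map f t, s) := by
  obtain ⟨k, w, h⟩ := exists_prismMap (t, s)
  obtain ⟨rfl, rfl⟩ := Prod.mk.inj h
  rw [stdSimplex_map_comp, prismLift_apply, prismLift_apply, pt, pt, op_comp, Functor.map_comp]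
  rfl

/-- The constant map to `[1]` with value `i`. -/
def constOne (n : SimplexCategory) (i : Fin 2) : n ⟶ SimplexCategory.mk 1 :=
  SimplexCategory.Hom.mk (OrderHom.const _ i)

lemma map_constOne (n : SimplexCategory) (i : Fin 2) (t : stdSimplex ℝ (Fin (n.len + 1))) :
    stdSimplex.map (constOne n i) t = stdSimplex.vertex i := by
  ext j
  rw [stdSimplex.map_coe, FunOnFinite.linearMap_apply_apply, stdSimplex.vertex_coe]
  by_cases h : i = j
  · subst h
    have : (Finset.univ.filter fun x => (constOne n i : Fin (n.len + 1) → Fin 2) x = i) =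
        Finset.univ := Finset.filter_true_of_mem fun _ _ => rfl
    rw [Pi.single_eq_same, this]
    exact stdSimplex.sum_eq_one t
  · have : (Finset.univ.filter fun x => (constOne n i : Fin (n.len + 1) → Fin 2) x = j) =
        ∅ := Finset.filter_false_of_mem fun _ _ => h
    rw [Pi.single_eq_of_ne' h, this, Finset.sum_empty]

lemma prismLift_vertex {n : SimplexCategory} (x : X.obj (Opposite.op n)) (i : Fin 2)
    (t : stdSimplex ℝ (Fin (n.len + 1))) :
    H.prismLift x (t, stdSimplex.vertex i) = realPt (H.app n x (constOne n i)) t := by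
  have h := H.prismLift_apply x (𝟙 n) (constOne n i) t
  rw [map_constOne, pt, op_id, CategoryTheory.Functor.map_id, stdSimplex_map_id] at h
  exact h

/-- The ends of a simplicial homotopy induce homotopic maps of geometric realizations. -/
theorem homotopic {f g : X ⟶ Y}
    (hf : ∀ (n : SimplexCategory) (x : X.obj (Opposite.op n)),
      H.app n x (constOne n 0) = f.app _ x)
    (hg : ∀ (n : SimplexCategory) (x : X.obj (Opposite.op n)),
      H.app n x (constOne n 1) = g.app _ x) :
    (SSet.toTop.map f).hom.Homotopic (SSet.toTop.map g).hom := by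
  -- Currying turns the homotopy into a map out of the realization of `X` alone, so no product of
  -- realizations has to be described.
  obtain ⟨Φ, hΦ⟩ := exists_realization_lift (X := X)
    (Z := TopCat.of C(stdSimplex ℝ (Fin 2), SSet.toTop.obj Y))
    (fun n x => (H.prismLift x).curry) (fun m n f x t => by
      ext s
      exact H.prismLift_map f x t s)
  let ev : ∀ s : stdSimplex ℝ (Fin 2), SSet.toTop.obj X ⟶ SSet.toTop.obj Y := fun s =>
    Φ ≫ TopCat.ofHom ⟨fun c : C(stdSimplex ℝ (Fin 2), SSet.toTop.obj Y) => c s,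
      continuous_eval_const s⟩
  have hev : ∀ s n (x : X.obj (Opposite.op n)) t, ev s (realPt x t) = H.prismLift x (t, s) := by
    intro s n x t
    exact DFunLike.congr_fun (hΦ n x t) s
  have h0 : ev (stdSimplex.vertex 0) = SSet.toTop.map f := by
    refine realization_hom_ext fun n x t => ?_
    rw [hev, prismLift_vertex, hf, map_realPt]
  have h1 : ev (stdSimplex.vertex 1) = SSet.toTop.map g := by
    refine realization_hom_ext fun n x t => ?_
    rw [hev, prismLift_vertex, hg, map_realPt]
  let K : C(SSet.toTop.obj X, C(stdSimplex ℝ (Fin 2), SSet.toTop.obj Y)) := Φ.hom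
  refine ⟨⟨⟨fun p => K p.2 (stdSimplexHomeomorphUnitInterval.symm p.1), ?_⟩, ?_, ?_⟩⟩
  · exact ContinuousEval.continuous_eval.comp ((K.continuous.comp continuous_snd).prodMk
      (stdSimplexHomeomorphUnitInterval.symm.continuous.comp continuous_fst))
  · intro y
    rw [← h0]
    change K y (stdSimplexHomeomorphUnitInterval.symm 0) = K y (stdSimplex.vertex 0)
    rw [← stdSimplexHomeomorphUnitInterval_zero, Homeomorph.symm_apply_apply]
  · intro y
    rw [← h1]
    change K y (stdSimplexHomeomorphUnitInterval.symm 1) = K y (stdSimplex.vertex 1)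
    rw [← stdSimplexHomeomorphUnitInterval_one, Homeomorph.symm_apply_apply]

end PrismHomotopy

end Homotopy

/-! ### Natural transformations induce homotopies -/

section Nerve

variable {C D : Type u} [Category.{v} C] [Category.{v} D] {F G : C ⥤ D}

/-- The simplicial homotopy defined by a natural transformation. -/
def nerveHomotopy (α : F ⟶ G) : PrismHomotopy (nerve C) (nerve D) where
  app _ x χ :=
    -- `α` is viewed as a functor from `[1]` to `C ⥤ D` and uncurried to `[1] × C ⥤ D`; the simplex
    -- `(χ, x)` is composed with it.
    ((SimplexCategory.toCat.map χ).toFunctor.prod' (show ComposableArrows C _ from x)) ⋙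
      Functor.uncurry.obj (ComposableArrows.mk₁ α)
  app_map _ _ _ := rfl

/-- The end of the homotopy at 0. Simplices of a nerve are functors, so an equality is needed and
not just an isomorphism. -/
lemma prod'_const_zero_comp_uncurry {J : Type w} [Category.{w} J] (α : F ⟶ G) (x : J ⥤ C) :
    ((Functor.const J).obj (0 : Fin 2)).prod' x ⋙
      Functor.uncurry.obj (ComposableArrows.mk₁ α) = x ⋙ F := by
  refine CategoryTheory.Functor.ext (fun _ => rfl) fun i j f => ?_
  have h : (((Functor.const J).obj (0 : Fin 2)).prod' x ⋙
      Functor.uncurry.obj (ComposableArrows.mk₁ α)).map f = F.map (x.map f) := by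
    simp only [Functor.comp_map, Functor.uncurry_obj_map, Functor.prod'_map, Functor.const_obj_map]
    exact Category.id_comp _
  exact h.trans ((Category.id_comp _).trans (Category.comp_id _)).symm

lemma prod'_const_one_comp_uncurry {J : Type w} [Category.{w} J] (α : F ⟶ G) (x : J ⥤ C) :
    ((Functor.const J).obj (1 : Fin 2)).prod' x ⋙
      Functor.uncurry.obj (ComposableArrows.mk₁ α) = x ⋙ G := by
  refine CategoryTheory.Functor.ext (fun _ => rfl) fun i j f => ?_
  have h : (((Functor.const J).obj (1 : Fin 2)).prod' x ⋙
      Functor.uncurry.obj (ComposableArrows.mk₁ α)).map f = G.map (x.map f) := by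
    simp only [Functor.comp_map, Functor.uncurry_obj_map, Functor.prod'_map, Functor.const_obj_map]
    exact Category.id_comp _
  exact h.trans ((Category.id_comp _).trans (Category.comp_id _)).symm

/-- Every homotopy in the theorem comes from here. `α` need not be invertible, which matters for the
zigzag of matroids. -/
theorem homotopic_of_natTrans (α : F ⟶ G) :
    (SSet.toTop.map (nerveMap F)).hom.Homotopic (SSet.toTop.map (nerveMap G)).hom :=
  (nerveHomotopy α).homotopic (fun _ x => prod'_const_zero_comp_uncurry α x)
    (fun _ x => prod'_const_one_comp_uncurry α x)

end Nerve

end BinaryMatroids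

namespace BinaryMatroids

/-! ### The matroid of a family of vectors -/

section LinearMatroid

variable {K : Type v} [Field K] {E : Type u} {V : Type w} [AddCommGroup V] [Module K V]

lemma ncard_eq_finrank_span [Finite E] {ρ : E → V} {I : Set E} (hI : LinearIndepOn K ρ I) :
    I.ncard = Module.finrank K (Submodule.span K (ρ '' I)) := by
  have : Fintype I := Fintype.ofFinite I
  rw [Set.image_eq_range, finrank_span_eq_card (b := fun x : I => ρ x) hI, ← Nat.card_eq_fintype_card,
    Nat.card_coe_set_eq]

/-- The matroid of a finite family of vectors. -/
noncomputable def linearMatroid [Finite E] (K : Type v) [Field K] [Module K V] (ρ : E → V) :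
    Matroid E :=
  (IndepMatroid.ofFinite (E := Set.univ) Set.finite_univ (fun I => LinearIndepOn K ρ I)
    (linearIndepOn_empty K ρ) (fun I J hJ hIJ => hJ.mono hIJ) (by
      intro I J hI hJ hlt
      -- Exchange: if no element of `J` extends `I`, then the span of `J` lies in that of `I`, so
      -- `J` is not larger than `I`.
      by_contra! h
      have hle : Submodule.span K (ρ '' J) ≤ Submodule.span K (ρ '' I) := by
        rw [Submodule.span_le]
        rintro _ ⟨e, he, rfl⟩
        by_cases heI : e ∈ I
        · exact Submodule.subset_span ⟨e, heI, rfl⟩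
        · by_contra hsp
          exact h e he heI (hI.insert hsp)
      have : FiniteDimensional K (Submodule.span K (ρ '' I)) :=
        FiniteDimensional.span_of_finite K (Set.toFinite _)
      have := Submodule.finrank_mono hle
      rw [← ncard_eq_finrank_span hI, ← ncard_eq_finrank_span hJ] at this
      lia) (fun I _ => Set.subset_univ I)).matroid

lemma linearMatroid_indep [Finite E] {ρ : E → V} {I : Set E} :
    (linearMatroid K ρ).Indep I ↔ LinearIndepOn K ρ I := Iff.rfl

lemma isRepresentation_linearMatroid [Finite E] {ρ : E → V}
    (h : Submodule.span K (Set.range ρ) = ⊤) : IsRepresentation K (linearMatroid K ρ) ρ :=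
  ⟨fun _ => linearMatroid_indep, h⟩

/-- The rank of a matroid is the dimension of the space in which it is represented. -/
lemma IsRepresentation.eRank_eq [Finite E] {M : Matroid E} {ρ : E → V}
    (hρ : IsRepresentation K M ρ) (hM : M.E = Set.univ) : M.eRank = Module.finrank K V := by
  obtain ⟨B, hB⟩ := M.exists_isBase
  have hBi := (hρ.indep_iff B).1 hB.indep
  have hsp : Submodule.span K (ρ '' B) = ⊤ := by
    rw [eq_top_iff, ← hρ.span_eq_top, Submodule.span_le]
    rintro _ ⟨e, rfl⟩
    by_cases he : e ∈ B
    · exact Submodule.subset_span ⟨e, he, rfl⟩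
    · by_contra h
      have := (hρ.indep_iff _).2 (hBi.insert h)
      exact (hB.insert_dep (e := e) ⟨by simp [hM], he⟩).not_indep this
  rw [← hB.encard_eq_eRank, ← (Set.toFinite B).cast_ncard_eq, ncard_eq_finrank_span hBi, hsp,
    finrank_top]

end LinearMatroid

/-! ### The matroid of all vectors of a space, and the zigzag of natural transformations -/

section Zigzag

/-- An injective map that is compatible with representations is a morphism of matroids. -/
def FinMatroid.homOfRepresentation {X Y : FinMatroid.{u}} {V W : Type u} [AddCommGroup V]
    [Module (ZMod 2) V] [AddCommGroup W] [Module (ZMod 2) W] {ρ : X.E → V} {τ : Y.E → W}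
    (hρ : ∀ I, X.M.Indep I ↔ LinearIndepOn (ZMod 2) ρ I)
    (hτ : ∀ I, Y.M.Indep I ↔ LinearIndepOn (ZMod 2) τ I) (f : X.E → Y.E)
    (hf : Function.Injective f) (L : V ≃ₗ[ZMod 2] W) (h : ∀ e, τ (f e) = L (ρ e)) : X ⟶ Y where
  toFun := f
  injective := hf
  indep_iff I := by
    rw [hρ, hτ]
    have h1 : LinearIndepOn (ZMod 2) τ (f '' I) ↔ LinearIndepOn (ZMod 2) (τ ∘ f) I :=
      (linearIndependent_equiv' (Equiv.Set.image f I hf) (by rfl)).symm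
    have h2 : τ ∘ f = L ∘ ρ := funext h
    rw [h1, h2]
    exact (LinearMap.linearIndependent_iff (v := fun x : I => ρ x) L.toLinearMap L.ker).symm

/-- Some representation factors through homology, so independent sets stay independent there. A
dependent set contains a circuit, whose classes satisfy the relation with all coefficients 1. -/
lemma linearIndepOn_iota_iff {E : Type u} [Finite E] {M : Matroid E} (hE : M.E = Set.univ)
    (hM : IsBinary M) (I : Set E) :
    M.Indep I ↔ LinearIndepOn (ZMod 2) (iota M) I := by
  refine ⟨linearIndepOn_iota hM, fun h => ?_⟩
  by_contra hI
  obtain ⟨C, hCI, hC⟩ := ((Matroid.not_indep_iff (by simp [hE])).1 hI).exists_isCircuit_subset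
  have hfin : C.Finite := Set.toFinite C
  have hsum := sum_iota_eq_zero M hfin.toFinset (by simpa using hC)
  have hli : LinearIndepOn (ZMod 2) (iota M) (hfin.toFinset : Set E) := by
    rw [hfin.coe_toFinset]
    exact h.mono hCI
  rw [linearIndepOn_finset_iff] at hli
  obtain ⟨e, he⟩ := hC.nonempty
  exact one_ne_zero (hli (fun _ => 1) (by simpa using hsum) e (by simpa using he))

/-- Because the field is finite, the set of all vectors is an admissible ground set. -/
lemma finite_of_equiv_pi {r : ℕ} {V : Type u} [AddCommGroup V] [Module (ZMod 2) V]
    (h : Nonempty (V ≃ₗ[ZMod 2] (Fin r → ZMod 2))) : Finite V :=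
  h.elim fun e => Finite.of_equiv _ e.symm.toEquiv

lemma finrank_of_equiv_pi {r : ℕ} {V : Type u} [AddCommGroup V] [Module (ZMod 2) V]
    (h : Nonempty (V ≃ₗ[ZMod 2] (Fin r → ZMod 2))) : Module.finrank (ZMod 2) V = r :=
  h.elim fun e => e.finrank_eq.trans (by simp)

/-- The binary matroid of a finite spanning family of vectors. -/
noncomputable def BinMat.ofFamily {r : ℕ} (V : FreeModOfRank.{u} (ZMod 2) r) {E : Type u}
    [hE : Finite E] (ρ : E → V.V) (h : Submodule.span (ZMod 2) (Set.range ρ) = ⊤) :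
    BinMat.{u} r where
  obj := ⟨E, hE, linearMatroid (ZMod 2) ρ, rfl⟩
  property := by
    refine ⟨⟨V.V, _, _, ρ, isRepresentation_linearMatroid h⟩, ?_⟩
    rw [(isRepresentation_linearMatroid h).eRank_eq rfl, finrank_of_equiv_pi V.equiv]

/-- The functor that sends a vector space to the matroid of all its vectors. -/
noncomputable def vectorMatroid (r : ℕ) : FreeModOfRank.{u} (ZMod 2) r ⥤ BinMat.{u} r where
  obj V :=
    haveI := finite_of_equiv_pi V.equiv
    BinMat.ofFamily V (E := V.V) id (by simp)
  map {V W} f :=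
    haveI := finite_of_equiv_pi V.equiv
    haveI := finite_of_equiv_pi W.equiv
    ObjectProperty.homMk (FinMatroid.homOfRepresentation
      (X := (BinMat.ofFamily V (E := V.V) id (by simp)).obj)
      (Y := (BinMat.ofFamily W (E := W.V) id (by simp)).obj)
      (V := V.V) (W := W.V) (ρ := fun x : V.V => x) (τ := fun x : W.V => x)
      (fun _ => Iff.rfl) (fun _ => Iff.rfl) (show V.V ≃ₗ[ZMod 2] W.V from f)
      (LinearEquiv.injective (show V.V ≃ₗ[ZMod 2] W.V from f)) f fun _ => rfl)
  map_id _ := rfl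
  map_comp _ _ := rfl

lemma BinMat.finite_H1Mod2 {r : ℕ} (X : BinMat.{u} r) : Finite (H1Mod2 X.obj.M) :=
  finite_of_equiv_pi ((H1Functor r).obj X).equiv

/-- The functor that adds all homology classes to a binary matroid. -/
noncomputable def addVectors (r : ℕ) : BinMat.{u} r ⥤ BinMat.{u} r where
  obj X :=
    haveI := X.obj.finite
    haveI := X.finite_H1Mod2
    -- The disjoint union makes both inclusions injective even when `iota` is not; each element
    -- becomes parallel to its class, or a loop if the class is zero.
    BinMat.ofFamily ((H1Functor r).obj X) (E := X.obj.E ⊕ H1Mod2 X.obj.M)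
      (Sum.elim (iota X.obj.M) id) (by
        rw [eq_top_iff]
        intro x _
        exact Submodule.subset_span ⟨Sum.inr x, rfl⟩)
  map {X Y} f := ObjectProperty.homMk (FinMatroid.homOfRepresentation
    (ρ := Sum.elim (iota X.obj.M) id) (τ := Sum.elim (iota Y.obj.M) id)
    (fun _ => Iff.rfl) (fun _ => Iff.rfl)
    (Sum.map f.hom.toFun (H1Mod2map f.hom))
    (f.hom.injective.sumMap (H1Mod2map_bijective X.property Y.property f.hom).1)
    ((H1Functor r).map f) (by
      rintro (e | x)
      · exact (H1Mod2map_iota f.hom e).symm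
      · rfl))
  map_id X := by
    refine ObjectProperty.hom_ext _ (FinMatroid.Hom.ext (funext ?_))
    rintro (e | x)
    · rfl
    · exact congrArg Sum.inr (LinearEquiv.congr_fun ((H1Functor r).map_id X) x)
  map_comp f g := by
    refine ObjectProperty.hom_ext _ (FinMatroid.Hom.ext (funext ?_))
    rintro (e | x)
    · rfl
    · exact congrArg Sum.inr (LinearEquiv.congr_fun ((H1Functor r).map_comp f g) x)

/-- The inclusion of a binary matroid into its enlargement by all homology classes. -/
noncomputable def addVectorsInl (r : ℕ) : 𝟭 (BinMat.{u} r) ⟶ addVectors r where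
  app X := ObjectProperty.homMk (FinMatroid.homOfRepresentation
    (X := X.obj) (Y := ((addVectors r).obj X).obj)
    (ρ := iota X.obj.M) (τ := Sum.elim (iota X.obj.M) id)
    (haveI := X.obj.finite; linearIndepOn_iota_iff X.obj.ground_eq X.property.1) (fun _ => Iff.rfl)
    Sum.inl Sum.inl_injective (LinearEquiv.refl _ _) fun _ => rfl)
  naturality _ _ _ := rfl

/-- The inclusion of the matroid of all homology classes into the enlargement of a binary
matroid. -/
noncomputable def addVectorsInr (r : ℕ) : H1Functor.{u} r ⋙ vectorMatroid r ⟶ addVectors r where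
  app X := ObjectProperty.homMk (FinMatroid.homOfRepresentation
    (X := ((H1Functor r ⋙ vectorMatroid r).obj X).obj) (Y := ((addVectors r).obj X).obj)
    (V := H1Mod2 X.obj.M) (W := H1Mod2 X.obj.M)
    (ρ := fun x : H1Mod2 X.obj.M => x) (τ := Sum.elim (iota X.obj.M) id)
    (fun _ => Iff.rfl) (fun _ => Iff.rfl)
    (Sum.inr : H1Mod2 X.obj.M → X.obj.E ⊕ H1Mod2 X.obj.M) Sum.inr_injective (LinearEquiv.refl _ _) fun _ => rfl)
  naturality _ _ _ := rfl

/-- The evaluation of homology classes in a representation. -/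
noncomputable def IsRepresentation.eval {E : Type u} {M : Matroid E} {V : Type w}
    [AddCommGroup V] [Module (ZMod 2) V] {ρ : E → V} (hρ : IsRepresentation (ZMod 2) M ρ) :
    H1Mod2 M →ₗ[ZMod 2] V :=
  LinearMap.liftBaseChange (ZMod 2) (H1.lift M ρ hρ.sum_eq_zero)

lemma IsRepresentation.eval_iota {E : Type u} {M : Matroid E} {V : Type w}
    [AddCommGroup V] [Module (ZMod 2) V] {ρ : E → V} (hρ : IsRepresentation (ZMod 2) M ρ)
    (e : E) : hρ.eval (iota M e) = ρ e := by
  simp [eval, iota]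

lemma isRepresentation_vectorMatroid {r : ℕ} (V : FreeModOfRank.{u} (ZMod 2) r) :
    IsRepresentation (E := V.V) (V := V.V) (ZMod 2) ((vectorMatroid r).obj V).obj.M id :=
  haveI := finite_of_equiv_pi V.equiv
  isRepresentation_linearMatroid (by simp)

/-- The homology of the matroid of all vectors of a space is that space. -/
noncomputable def vectorMatroidCounit (r : ℕ) :
    vectorMatroid.{u} r ⋙ H1Functor r ⟶ 𝟭 (FreeModOfRank.{u} (ZMod 2) r) where
  app V := LinearEquiv.ofBijective (isRepresentation_vectorMatroid V).eval (by
    have hH := ((H1Functor r).obj ((vectorMatroid r).obj V)).equiv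
    have : Module.Finite (ZMod 2) V.V := V.equiv.elim fun e => Module.Finite.equiv e.symm
    have : Module.Finite (ZMod 2) ((H1Functor r).obj ((vectorMatroid r).obj V)).V :=
      hH.elim fun e => Module.Finite.equiv e.symm
    -- Each vector is itself an element of the matroid. Both spaces have dimension `r`, so
    -- surjectivity suffices.
    have hs : Function.Surjective (isRepresentation_vectorMatroid V).eval := fun v =>
      ⟨iota _ v, (isRepresentation_vectorMatroid V).eval_iota v⟩
    exact ⟨(LinearMap.injective_iff_surjective_of_finrank_eq_finrank
      ((finrank_of_equiv_pi hH).trans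
        (finrank_of_equiv_pi V.equiv).symm)).2 hs, hs⟩)
  naturality V W f := by
    apply LinearEquiv.toLinearMap_injective
    apply H1Mod2.hom_ext
    intro e
    refine (congrArg (isRepresentation_vectorMatroid W).eval (H1Mod2map_iota _ e)).trans ?_
    refine ((isRepresentation_vectorMatroid W).eval_iota _).trans ?_
    exact (congrArg (show V.V ≃ₗ[ZMod 2] W.V from f) ((isRepresentation_vectorMatroid V).eval_iota e)).symm

end Zigzag

/-- The inverse is induced by `vectorMatroid`: one composite is joined to the identity by the zigzag
through `addVectors`, the other by the counit. -/
lemma isHomotopyEquiv_H1Functor (r : ℕ) : IsHomotopyEquiv (Bmap (H1Functor.{u} r)) := by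
  refine ⟨Bmap (vectorMatroid r), ?_, ?_⟩
  · have h := (homotopic_of_natTrans (addVectorsInr.{u} r)).trans
      (homotopic_of_natTrans (addVectorsInl r)).symm
    have h1 : nerveMap (H1Functor.{u} r ⋙ vectorMatroid r) =
      nerveMap (H1Functor r) ≫ nerveMap (vectorMatroid r) := rfl
    have h2 : nerveMap (𝟭 (BinMat.{u} r)) = 𝟙 _ := rfl
    rw [h1, h2, Functor.map_comp, CategoryTheory.Functor.map_id] at h
    exact h
  · have h := homotopic_of_natTrans (vectorMatroidCounit.{u} r)
    have h1 : nerveMap (vectorMatroid.{u} r ⋙ H1Functor r) =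
      nerveMap (vectorMatroid r) ≫ nerveMap (H1Functor r) := rfl
    have h2 : nerveMap (𝟭 (FreeModOfRank.{u} (ZMod 2) r)) = 𝟙 _ := rfl
    rw [h1, h2, Functor.map_comp, CategoryTheory.Functor.map_id] at h
    exact h

end BinaryMatroids

namespace BinaryMatroids

/-! ### The groupoid of free modules and the general linear group -/

section GeneralLinear

variable (R : Type) [CommRing R] (r : ℕ)

/-- Invertible matrices are the linear automorphisms of `R^r`. -/
noncomputable def glEquiv :
    Matrix.GeneralLinearGroup (Fin r) R ≃* ((Fin r → R) ≃ₗ[R] (Fin r → R)) :=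
  Matrix.GeneralLinearGroup.toLin.trans (LinearMap.GeneralLinearGroup.generalLinearEquiv R _)

/-- The functor from the one-object category of `GL(r, R)` given by the action on `R^r`. -/
noncomputable def glInclusion :
    SingleObj (ULift.{u + 1} (Matrix.GeneralLinearGroup (Fin r) R)) ⥤
      FreeModOfRank.{u} R r where
  obj _ := ⟨ULift.{u} (Fin r → R), ⟨ULift.moduleEquiv⟩⟩
  map g := ULift.moduleEquiv.trans ((glEquiv R r (ULift.down g)).trans ULift.moduleEquiv.symm)
  map_id _ := by
    apply LinearEquiv.ext
    intro x
    change ULift.up (glEquiv R r 1 x.down) = x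
    rw [map_one]
    rfl
  map_comp f g := by
    apply LinearEquiv.ext
    intro x
    -- Composition in `SingleObj` reverses the product, which matches `f.trans g` being `g` after
    -- `f`.
    change ULift.up (glEquiv R r (ULift.down g * ULift.down f) x.down) = _
    rw [map_mul]
    rfl

variable {R r}

/-- A coordinate system of a free module. -/
noncomputable def FreeModOfRank.coord (V : FreeModOfRank.{u} R r) : V.V ≃ₗ[R] (Fin r → R) :=
  V.equiv.some

/-- The matrix of an isomorphism, with respect to the chosen coordinates. -/
noncomputable def FreeModOfRank.matrix {V W : FreeModOfRank.{u} R r} (f : V.V ≃ₗ[R] W.V) :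
    Matrix.GeneralLinearGroup (Fin r) R :=
  (glEquiv R r).symm (V.coord.symm.trans (f.trans W.coord))

variable (R r)

/-- The functor that sends an isomorphism to its matrix in the chosen coordinates. -/
noncomputable def glMatrix :
    FreeModOfRank.{u} R r ⥤
      SingleObj (ULift.{u + 1} (Matrix.GeneralLinearGroup (Fin r) R)) where
  obj _ := SingleObj.star _
  map f := ULift.up (FreeModOfRank.matrix f)
  map_id V := by
    refine congrArg ULift.up ((glEquiv R r).symm_apply_eq.2 ?_)
    rw [map_one]
    apply LinearEquiv.ext
    intro x
    exact V.coord.apply_symm_apply x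
  map_comp {V W Z} f g := by
    refine congrArg ULift.up ((glEquiv R r).symm_apply_eq.2 ?_)
    rw [map_mul, FreeModOfRank.matrix, FreeModOfRank.matrix, MulEquiv.apply_symm_apply,
      MulEquiv.apply_symm_apply]
    apply LinearEquiv.ext
    intro x
    exact congrArg (fun y => Z.coord ((show W.V ≃ₗ[R] Z.V from g) y))
      (W.coord.symm_apply_apply ((show V.V ≃ₗ[R] W.V from f) (V.coord.symm x))).symm

/-- The coordinates define a natural transformation. -/
noncomputable def glUnit : 𝟭 (FreeModOfRank.{u} R r) ⟶ glMatrix R r ⋙ glInclusion R r where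
  app V := V.coord.trans ULift.moduleEquiv.symm
  naturality V W f := by
    apply LinearEquiv.ext
    intro x
    change ULift.up (W.coord ((show V.V ≃ₗ[R] W.V from f) x)) =
      ULift.up (glEquiv R r (FreeModOfRank.matrix f) (V.coord x))
    rw [FreeModOfRank.matrix, MulEquiv.apply_symm_apply]
    exact congrArg (fun y => ULift.up (W.coord ((show V.V ≃ₗ[R] W.V from f) y)))
      (V.coord.symm_apply_apply x).symm

/-- The chosen coordinates of `R^r` define a natural transformation. -/
noncomputable def glCounit :
    glInclusion.{u} R r ⋙ glMatrix R r ⟶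
      𝟭 (SingleObj (ULift.{u + 1} (Matrix.GeneralLinearGroup (Fin r) R))) where
  -- The coordinates chosen on `R^r` need not be the standard ones; the component is the change of
  -- basis between them.
  app x := ULift.up ((glEquiv R r).symm
    (((glInclusion R r).obj x).coord.symm.trans ULift.moduleEquiv))
  naturality x y g := by
    apply ULift.down_injective
    apply (glEquiv R r).injective
    change glEquiv R r ((glEquiv R r).symm _ * (glEquiv R r).symm _) =
      glEquiv R r (ULift.down g * (glEquiv R r).symm _)
    rw [map_mul, map_mul, MulEquiv.apply_symm_apply, MulEquiv.apply_symm_apply,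
      MulEquiv.apply_symm_apply]
    apply LinearEquiv.ext
    intro z
    exact congrArg ULift.down (((glInclusion R r).obj y).coord.symm_apply_apply
      (ULift.up (glEquiv R r (ULift.down g)
        (ULift.down (((glInclusion R r).obj x).coord.symm z)))))

/-- The simplicial map of nerves induced by `glMatrix`. -/
noncomputable def glMatrixNerve :
    nerve (FreeModOfRank.{u} R r) ⟶
      nerve (SingleObj (ULift.{u + 1} (Matrix.GeneralLinearGroup (Fin r) R))) where
  -- The morphisms of the two categories lie in the universes `u` and `u + 1`, so the map is written
  -- out on simplices. Its composites with `glInclusionNerve` are still `nerveMap`s by definition.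
  app _ := ↾fun x => (show ComposableArrows _ _ from x) ⋙ glMatrix R r

/-- The simplicial map of nerves induced by `glInclusion`. -/
noncomputable def glInclusionNerve :
    nerve (SingleObj (ULift.{u + 1} (Matrix.GeneralLinearGroup (Fin r) R))) ⟶
      nerve (FreeModOfRank.{u} R r) where
  app _ := ↾fun x => (show ComposableArrows _ _ from x) ⋙ glInclusion R r

/-- The classifying space of the groupoid of free modules of rank `r` is the classifying space of
the general linear group. -/
noncomputable def homotopyEquivBGroup :
    ContinuousMap.HomotopyEquiv (B (FreeModOfRank.{u} R r))
      (BGroup.{0, u + 1} (Matrix.GeneralLinearGroup (Fin r) R)) where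
  toFun := (SSet.toTop.map (glMatrixNerve R r)).hom
  invFun := (SSet.toTop.map (glInclusionNerve R r)).hom
  left_inv := by
    have h := (homotopic_of_natTrans (glUnit.{u} R r)).symm
    have h1 : nerveMap (glMatrix.{u} R r ⋙ glInclusion R r) =
      glMatrixNerve R r ≫ glInclusionNerve R r := rfl
    have h2 : nerveMap (𝟭 (FreeModOfRank.{u} R r)) = 𝟙 _ := rfl
    rw [h1, h2, Functor.map_comp, CategoryTheory.Functor.map_id] at h
    exact h
  right_inv := by
    have h := homotopic_of_natTrans (glCounit.{u} R r)
    have h1 : nerveMap (glInclusion.{u} R r ⋙ glMatrix R r) =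
      glInclusionNerve R r ≫ glMatrixNerve R r := rfl
    have h2 : nerveMap (𝟭 (SingleObj (ULift.{u + 1} (Matrix.GeneralLinearGroup (Fin r) R)))) =
      𝟙 _ := rfl
    rw [h1, h2, Functor.map_comp, CategoryTheory.Functor.map_id] at h
    exact h

end GeneralLinear

end BinaryMatroids

theorem mainTheorem3 (r : ℕ) :
    BinaryMatroids.IsHomotopyEquiv (BinaryMatroids.Bmap (BinaryMatroids.H1Functor.{u} r)) ∧
      Nonempty (ContinuousMap.HomotopyEquiv
        (BinaryMatroids.B (BinaryMatroids.FreeModOfRank.{u} (ZMod 2) r))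
        (BinaryMatroids.BGroup.{0, u + 1} (Matrix.GeneralLinearGroup (Fin r) (ZMod 2)))) :=
  ⟨BinaryMatroids.isHomotopyEquiv_H1Functor r, ⟨BinaryMatroids.homotopyEquivBGroup (ZMod 2) r⟩⟩
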